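/- **Theorem.** Let $n\ge 0$ and $q\ge 2$ be integers. The complexity $c(G)$ of a finite graph $G$ is the number of its spanning trees. The nonbinary hypercube $C_q(n)$ is the graph whose vertices are the $n$-tuples $a=(a_1,\dots,a_n)$ with entries in $\{0,1,\dots,q-1\}$, where, with $\operatorname{supp}(a)=\{i: a_i\ne 0\}$, two vertices $a,b$ are joined by an edge if and only if $\operatorname{supp}(a)\subseteq\operatorname{supp}(b)$ or $\operatorname{supp}(b)\subseteq\operatorname{supp}(a)$, $\bigl||\operatorname{supp}(a)|-|\operatorname{supp}(b)|\bigr|=1$, and $a_i=b_i$ for all $i\in\operatorname{supp}(a)\cap\operatorname{supp}(b)$. For $0\le k\le n$ put $\underline{k}=\max\{0,2k-n\}$. Then $$ c(C_q(n)) = n!\,\prod_{k=1}^{n}\ \prod_{l=\underline{k}}^{k}\left(\prod_{j=k}^{n+l-k}\bigl(qj-(q-1)l\bigr)\right)^{(q-2)^l\binom{n}{l}\left\{\binom{n-l}{k-l}-\binom{n-l}{k-l-1}\right\}}, $$ where $0^0=1$ and $\binom{m}{-1}=0$. For $q=2$ the graph $C_2(n)$ is isomorphic to the binary hypercube $C(n)$,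 whose vertices are the subsets of $\{1,\dots,n\}$, with $X,Y$ joined by an edge if and only if $X\subseteq Y$ or $Y\subseteq X$, and $\bigl||X|-|Y|\bigr|=1$. For $q=2$ the right-hand side above equals $n!\prod_{k=1}^{\lfloor n/2\rfloor}\bigl(\prod_{j=k}^{n-k}2j\bigr)^{\binom nk-\binom n{k-1}}$, which equals $\prod_{k=2}^n(2k)^{\binom nk}$, so that the theorem reduces to the classical formula $c(C(n))=\prod_{k=2}^n(2k)^{\binom nk}$. -/

import Mathlib

/-- The complexity of a graph: the number of its spanning trees, i.e. of the trees on the whole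
vertex set all of whose edges are edges of `G`. -/
noncomputable def complexity {V : Type*} (G : SimpleGraph V) : ℕ :=
  {T : SimpleGraph V | T ≤ G ∧ T.IsTree}.ncard

/-- The support of an `n`-tuple with entries in `{0, 1, ..., q - 1}`. -/
def tupleSupp {q n : ℕ} (a : Fin n → Fin q) : Finset (Fin n) :=
  Finset.univ.filter fun i => (a i : ℕ) ≠ 0

/-- The nonbinary hypercube `C_q(n)`. -/
def nonbinaryHypercube (q n : ℕ) : SimpleGraph (Fin n → Fin q) where
  Adj a b :=
    (tupleSupp a ⊆ tupleSupp b ∨ tupleSupp b ⊆ tupleSupp a) ∧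
      |((tupleSupp a).card : ℤ) - ((tupleSupp b).card : ℤ)| = 1 ∧
      ∀ i ∈ tupleSupp a ∩ tupleSupp b, a i = b i
  symm := ⟨fun a b h => ⟨h.1.symm, by rw [abs_sub_comm]; exact h.2.1, fun i hi =>
    (h.2.2 i (by rwa [Finset.inter_comm])).symm⟩⟩
  loopless := ⟨fun a h => by simpa using h.2.1⟩

/-- The binary hypercube `C(n)`, on the subsets of an `n`-set. -/
def binaryHypercube (n : ℕ) : SimpleGraph (Finset (Fin n)) where
  Adj X Y := (X ⊆ Y ∨ Y ⊆ X) ∧ |(X.card : ℤ) - (Y.card : ℤ)| = 1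
  symm := ⟨fun X Y h => ⟨h.1.symm, by rw [abs_sub_comm]; exact h.2⟩⟩
  loopless := ⟨fun X h => by simpa using h.2⟩

/-- The binomial coefficient with an integer lower index, equal to `0` if that index is
negative. -/
def binom (m : ℕ) (j : ℤ) : ℤ :=
  if 0 ≤ j then (m.choose j.toNat : ℤ) else 0

/-! An edge of `C_q(n)` changes one coordinate between zero and nonzero, so the graph is the
`n`-fold Cartesian power of the star with `q - 1` leaves (`nonbinaryHypercube_isCartesianPower`).
With `q = p + 2`, the star Laplacian has eigenvalues `0`, `q`, and `1` (`p` times). Tensor products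
of its eigenvectors diagonalize the Laplacian of the power, and their eigenvalues add: `l + q m`
arises `p^l C(n,l) C(n-l,m)` times. By the matrix tree theorem (`adjugate_lapMatrix_apply_self`),
proved by expanding a cofactor over parent functions, the product of the nonzero eigenvalues is
`q^n` times the complexity.

One copy each of `q, 2q, ..., nq` gives `q^n n!`; cancelling `q^n` leaves `n!` and lowers the
multiplicities for `l = 0` by one. The stated product is the same one reordered: with `j = l + m`,
for fixed `l` and `j` the differences of binomials telescope over `k` to `C(n-l, j-l)`, less `1`
when `l = 0` (`sum_binom_sub_binom`). -/

/-! ### Parent functions, rooted trees and the matrix tree theorem. -/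

/-- The matrix with rows `e_r` for the root and `e_v - e_{f v}` for the other vertices. -/
def parentMatrix {V : Type*} [DecidableEq V] (R : Type*) [Ring R] (r : V) (f : V → V) :
    Matrix V V R :=
  fun v => if v = r then Pi.single r 1 else Pi.single v 1 - Pi.single (f v) 1

theorem iterate_eq_root_iff {V : Type*} {r v : V} {f : V → V} (hv : v ≠ r) :
    (∃ k, f^[k] (f v) = r) ↔ ∃ k, f^[k] v = r := by
  constructor
  · rintro ⟨k, hk⟩
    exact ⟨k + 1, hk⟩
  · rintro ⟨k, hk⟩
    cases k with
    | zero => exact absurd hk hv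
    | succ k => exact ⟨k, hk⟩

/-- If every vertex reaches the root, there is a depth function. -/
theorem exists_depth {V : Type*} {r : V} {f : V → V} (h : ∀ v, ∃ k, f^[k] v = r) :
    ∃ d : V → ℕ, ∀ v, v ≠ r → d v = d (f v) + 1 := by
  classical
  refine ⟨fun v => Nat.find (h v), fun v hv => ?_⟩
  rw [Nat.find_eq_iff]
  refine ⟨Nat.find_spec (h (f v)), fun m hm => ?_⟩
  cases m with
  | zero => exact hv
  | succ m => exact Nat.find_min (h (f v)) (Nat.lt_of_succ_lt_succ hm)

/-- Since `f v` is strictly shallower than `v`, ordering the vertices by depth makes the matrix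
block triangular with identity blocks. -/
theorem det_parentMatrix_of_reaches {V : Type*} [Fintype V] [DecidableEq V] {R : Type*}
    [CommRing R] {r : V} {f : V → V} (h : ∀ v, ∃ k, f^[k] v = r) :
    (parentMatrix R r f).det = 1 := by
  obtain ⟨d, hd⟩ := exists_depth h
  have key : ∀ i j, d i ≤ d j → parentMatrix R r f i j = if i = j then 1 else 0 := by
    intro i j hij
    unfold parentMatrix
    by_cases hi : i = r
    · subst hi
      simp [Pi.single_apply, eq_comm]
    · have : j ≠ f i := by
        rintro rfl
        have := hd i hi
        omega
      simp [hi, Pi.single_apply, this, eq_comm]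
  have hT : (parentMatrix R r f).BlockTriangular (fun v => OrderDual.toDual (d v)) := by
    intro i j hij
    have hij' : d i < d j := hij
    rw [key i j hij'.le, if_neg]
    rintro rfl
    exact lt_irrefl _ hij'
  rw [hT.det]
  refine Finset.prod_eq_one fun a _ => ?_
  have hone : (parentMatrix R r f).toSquareBlock (fun v => OrderDual.toDual (d v)) a = 1 := by
    ext ⟨i, hi⟩ ⟨j, hj⟩
    have : d i = d j := OrderDual.toDual.injective (hi.trans hj.symm)
    rw [Matrix.toSquareBlock_def, Matrix.of_apply, key i j this.le, Matrix.one_apply]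
    simp
  rw [hone, Matrix.det_one]

/-- The indicator of the vertices that never reach `r` is a nonzero kernel vector: for `v ≠ r`, both
`v` and `f v` reach `r` or neither does. -/
theorem det_parentMatrix_of_not_reaches {V : Type*} [Fintype V] [DecidableEq V] {R : Type*}
    [CommRing R] [IsDomain R] {r : V} {f : V → V} (h : ¬ ∀ v, ∃ k, f^[k] v = r) :
    (parentMatrix R r f).det = 0 := by
  classical
  push Not at h
  obtain ⟨v₀, hv₀⟩ := h
  rw [← Matrix.exists_mulVec_eq_zero_iff]
  refine ⟨fun v => if ∃ k, f^[k] v = r then 0 else 1, ?_, ?_⟩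
  · intro h0
    have := congrFun h0 v₀
    simp [hv₀] at this
  · ext v
    by_cases hv : v = r
    · subst hv
      have : ∃ k, f^[k] v = v := ⟨0, rfl⟩
      simp [parentMatrix, Matrix.mulVec, this]
    · simp only [parentMatrix, Matrix.mulVec, hv, if_false, sub_dotProduct,
        single_dotProduct, one_mul, iterate_eq_root_iff hv, sub_self, Pi.zero_apply]

/-- The graph of a parent function. -/
def parentGraph {V : Type*} (r : V) (f : V → V) : SimpleGraph V :=
  SimpleGraph.fromRel fun v w => v ≠ r ∧ f v = w

theorem parentGraph_adj {V : Type*} {r : V} {f : V → V} {v w : V} :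
    (parentGraph r f).Adj v w ↔ v ≠ w ∧ ((v ≠ r ∧ f v = w) ∨ (w ≠ r ∧ f w = v)) := by
  simp [parentGraph]

theorem parentGraph_connected {V : Type*} {r : V} {f : V → V} (h : ∀ v, ∃ k, f^[k] v = r) :
    (parentGraph r f).Connected := by
  obtain ⟨d, hd⟩ := exists_depth h
  have hr : ∀ n v, d v = n → (parentGraph r f).Reachable v r := by
    intro n
    induction n with
    | zero =>
      intro v hv
      by_cases hvr : v = r
      · rw [hvr]
      · have := hd v hvr
        omega
    | succ n ih =>
      intro v hv
      by_cases hvr : v = r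
      · rw [hvr]
      · have h1 := hd v hvr
        have hadj : (parentGraph r f).Adj v (f v) := by
          rw [parentGraph_adj]
          refine ⟨fun h2 => ?_, Or.inl ⟨hvr, rfl⟩⟩
          rw [← h2] at h1
          omega
        exact hadj.reachable.trans (ih (f v) (by omega))
  have : Nonempty V := ⟨r⟩
  exact ⟨fun u v => (hr _ u rfl).trans (hr _ v rfl).symm⟩

/-- Every edge has the form `v — f v` with `v ≠ r`, so there are at most `|V| - 1` edges, the fewest
a connected graph can have. -/
theorem parentGraph_isTree {V : Type*} [Finite V] {r : V} {f : V → V}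
    (h : ∀ v, ∃ k, f^[k] v = r) : (parentGraph r f).IsTree := by
  classical
  have := Fintype.ofFinite V
  have hc := parentGraph_connected h
  rw [SimpleGraph.isTree_iff_connected_and_card]
  refine ⟨hc, le_antisymm ?_ hc.card_vert_le_card_edgeSet_add_one⟩
  have hsub : (parentGraph r f).edgeSet ⊆
      (((Finset.univ.erase r).image fun v => s(v, f v) : Finset (Sym2 V)) : Set (Sym2 V)) := by
    intro e
    induction e with | _ a b
    simp only [SimpleGraph.mem_edgeSet, parentGraph_adj, Finset.coe_image, Set.mem_image,
      Finset.mem_coe, Finset.mem_erase, Finset.mem_univ, and_true]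
    rintro ⟨-, ⟨h1, rfl⟩ | ⟨h1, rfl⟩⟩
    · exact ⟨a, h1, rfl⟩
    · exact ⟨b, h1, Sym2.eq_swap⟩
  have h1 := Set.ncard_le_ncard hsub (Finset.finite_toSet _)
  rw [Set.ncard_coe_finset] at h1
  have h2 := h1.trans Finset.card_image_le
  rw [Finset.card_erase_of_mem (Finset.mem_univ r), Finset.card_univ,
    ← Nat.card_eq_fintype_card] at h2
  have h3 : 0 < Nat.card V := Nat.card_pos_iff.2 ⟨⟨r⟩, inferInstance⟩
  rw [Nat.card_coe_set_eq]
  omega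

theorem parentGraph_injective {V : Type*} {r : V} {f g : V → V}
    (hf : ∀ v, ∃ k, f^[k] v = r) (hfr : f r = r) (hgr : g r = r)
    (h : parentGraph r f = parentGraph r g) : f = g := by
  obtain ⟨d, hd⟩ := exists_depth hf
  have key : ∀ n v, d v = n → f v = g v := by
    intro n
    induction n using Nat.strong_induction_on with
    | _ n ih =>
      intro v hv
      by_cases hvr : v = r
      · rw [hvr, hfr, hgr]
      have h1 := hd v hvr
      have hadj : (parentGraph r f).Adj v (f v) := by
        rw [parentGraph_adj]
        refine ⟨fun h2 => ?_, Or.inl ⟨hvr, rfl⟩⟩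
        rw [← h2] at h1
        omega
      rw [h, parentGraph_adj] at hadj
      obtain ⟨-, ⟨-, h2⟩ | ⟨h2, h3⟩⟩ := hadj
      · exact h2.symm
      -- The edge is oriented backwards by `g`, so `g (f v) = v`. Induction at the shallower vertex
      -- `f v` gives `f (f v) = v`, against the depths.
      · have h4 := ih (d (f v)) (by omega) (f v) rfl
        have h5 := hd (f v) h2
        rw [h4, h3] at h5
        omega
  exact funext fun v => key _ v rfl

/-- Every tree is the graph of a parent function. -/
theorem exists_parentGraph_eq {V : Type*} {T : SimpleGraph V} (hT : T.IsTree) (r : V) :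
    ∃ f : V → V, f r = r ∧ (∀ v, v ≠ r → T.Adj v (f v)) ∧ (∀ v, ∃ k, f^[k] v = r) ∧
      parentGraph r f = T := by
  classical
  -- The parent of `v` is the next vertex on a shortest walk to `r`.
  have hstep : ∀ v, v ≠ r → ∃ w, T.Adj v w ∧ T.dist w r < T.dist v r := by
    intro v hv
    obtain ⟨p, hp⟩ := hT.connected.exists_walk_length_eq_dist v r
    cases p with
    | nil => exact absurd rfl hv
    | cons hadj q =>
      refine ⟨_, hadj, ?_⟩
      have := SimpleGraph.dist_le q
      rw [SimpleGraph.Walk.length_cons] at hp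
      omega
  choose! f hf using hstep
  let g : V → V := fun v => if v = r then r else f v
  have hg : ∀ v, v ≠ r → T.Adj v (g v) ∧ T.dist (g v) r < T.dist v r := by
    intro v hv
    simpa [g, hv] using hf v hv
  have hreach : ∀ v, ∃ k, g^[k] v = r := by
    have : ∀ n v, T.dist v r = n → ∃ k, g^[k] v = r := by
      intro n
      induction n using Nat.strong_induction_on with
      | _ n ih =>
        intro v hv
        by_cases hvr : v = r
        · exact ⟨0, hvr⟩
        · rw [← iterate_eq_root_iff hvr]
          exact ih _ (hv ▸ (hg v hvr).2) _ rfl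
    exact fun v => this _ v rfl
  refine ⟨g, by simp [g], fun v hv => (hg v hv).1, hreach, ?_⟩
  have hle : parentGraph r g ≤ T := by
    intro a b hab
    rw [parentGraph_adj] at hab
    obtain ⟨-, ⟨h1, rfl⟩ | ⟨h1, rfl⟩⟩ := hab
    · exact (hg a h1).1
    · exact (hg b h1).1.symm
  exact le_antisymm hle
    ((SimpleGraph.isTree_iff_minimal_connected.1 hT).2 (parentGraph_connected hreach) hle)

/-- **Matrix tree theorem**: the diagonal cofactors of the Laplacian count spanning trees. -/
theorem adjugate_lapMatrix_apply_self {V : Type*} [Fintype V] [DecidableEq V] {R : Type*}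
    [CommRing R] [IsDomain R] (G : SimpleGraph V) [DecidableRel G.Adj] (r : V) :
    (G.lapMatrix R).adjugate r r = complexity G := by
  classical
  let A : V → Finset V := fun v => if v = r then {r} else G.neighborFinset v
  -- The row at `v ≠ r` is the sum of `e_v - e_w` over the neighbours `w`, so multilinearity expands
  -- the cofactor over choices of a parent for each vertex. The singleton at `r` forces `f r = r`.
  have hmat : (G.lapMatrix R).updateRow r (Pi.single r 1) = Matrix.of fun v =>
      ∑ w ∈ A v, (if v = r then Pi.single r 1 else Pi.single v 1 - Pi.single w 1 : V → R) := by
    ext v w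
    by_cases hv : v = r
    · subst hv
      simp [A]
    · rw [Matrix.updateRow_ne hv]
      simp only [A, hv, if_false, Matrix.of_apply, Finset.sum_apply, Pi.sub_apply,
        Finset.sum_sub_distrib, Finset.sum_const, SimpleGraph.card_neighborFinset_eq_degree,
        SimpleGraph.lapMatrix, Matrix.sub_apply, SimpleGraph.degMatrix, Matrix.diagonal_apply,
        SimpleGraph.adjMatrix_apply, Pi.single_apply,
        nsmul_eq_mul, mul_ite, mul_one, mul_zero, @eq_comm _ w]
      simp
  rw [Matrix.adjugate_apply, hmat]
  have hexp := MultilinearMap.map_sum_finset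
    (Matrix.detRowAlternating : (V → R) [⋀^V]→ₗ[R] R).toMultilinearMap
    (fun v w => (if v = r then Pi.single r 1 else Pi.single v 1 - Pi.single w 1 : V → R)) A
  refine hexp.trans ?_
  have hdet : ∀ f ∈ Fintype.piFinset A,
      (Matrix.detRowAlternating : (V → R) [⋀^V]→ₗ[R] R).toMultilinearMap
        (fun v => (if v = r then Pi.single r 1 else Pi.single v 1 - Pi.single (f v) 1 : V → R)) =
      if ∀ v, ∃ k, f^[k] v = r then 1 else 0 := by
    intro f _
    split_ifs with h
    · exact det_parentMatrix_of_reaches h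
    · exact det_parentMatrix_of_not_reaches h
  rw [Finset.sum_congr rfl hdet, Finset.sum_boole]
  congr 1
  have hA : ∀ f, f ∈ Fintype.piFinset A ↔ f r = r ∧ ∀ v, v ≠ r → G.Adj v (f v) := by
    intro f
    rw [Fintype.mem_piFinset]
    constructor
    · intro h
      refine ⟨by simpa [A] using h r, fun v hv => by simpa [A, hv] using h v⟩
    · rintro ⟨h1, h2⟩ v
      by_cases hv : v = r
      · subst hv
        simpa [A] using h1
      · simpa [A, hv] using h2 v hv
  rw [complexity, ← Set.ncard_coe_finset]
  refine Set.ncard_congr (fun f _ => parentGraph r f) ?_ ?_ ?_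
  · intro f hf
    rw [Finset.mem_coe, Finset.mem_filter, hA] at hf
    refine ⟨?_, parentGraph_isTree hf.2⟩
    intro a b hab
    rw [parentGraph_adj] at hab
    obtain ⟨-, ⟨h1, rfl⟩ | ⟨h1, rfl⟩⟩ := hab
    · exact hf.1.2 a h1
    · exact (hf.1.2 b h1).symm
  · intro f g hf hg h
    rw [Finset.mem_coe, Finset.mem_filter, hA] at hf hg
    exact parentGraph_injective hf.2 hf.1.1 hg.1.1 h
  · rintro T ⟨hTG, hT⟩
    obtain ⟨f, hfr, hadj, hreach, hfT⟩ := exists_parentGraph_eq hT r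
    refine ⟨f, ?_, hfT⟩
    rw [Finset.mem_coe, Finset.mem_filter, hA]
    exact ⟨⟨hfr, fun v hv => hTG (hadj v hv)⟩, hreach⟩

/-! ### Complexity from the Laplacian spectrum. -/

/-- If the Laplacian is diagonalized by `P`, with a zero eigenvalue at `i₀`, then the product of the
other eigenvalues is the number of vertices times the number of spanning trees. -/
theorem card_mul_complexity_eq_prod {V : Type*} [Fintype V] [DecidableEq V] {R : Type*}
    [CommRing R] [IsDomain R] (G : SimpleGraph V) [DecidableRel G.Adj] {P Q : Matrix V V R}
    {d : V → R} (hPQ : P * Q = 1) (h : G.lapMatrix R * P = P * Matrix.diagonal d) {i₀ : V}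
    (h0 : d i₀ = 0) :
    (Fintype.card V : R) * complexity G = ∏ i ∈ Finset.univ.erase i₀, d i := by
  have hL : G.lapMatrix R = P * Matrix.diagonal d * Q := by
    rw [← h, Matrix.mul_assoc, hPQ, Matrix.mul_one]
  have htr : (G.lapMatrix R).adjugate.trace = (Fintype.card V : R) * complexity G := by
    simp [Matrix.trace, Matrix.diag, adjugate_lapMatrix_apply_self]
  rw [← htr, hL, Matrix.adjugate_mul_distrib, Matrix.adjugate_mul_distrib, Matrix.trace_mul_comm,
    Matrix.mul_assoc, ← Matrix.adjugate_mul_distrib, mul_eq_one_comm.1 hPQ, Matrix.adjugate_one,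
    Matrix.mul_one, Matrix.adjugate_diagonal, Matrix.trace_diagonal]
  -- The trace of the adjugate of the diagonal matrix sums products omitting one entry; those that
  -- keep `d i₀ = 0` vanish.
  refine Finset.sum_eq_single_of_mem i₀ (Finset.mem_univ _) fun i _ hi => ?_
  exact Finset.prod_eq_zero (Finset.mem_erase.2 ⟨hi.symm, Finset.mem_univ _⟩) h0

theorem lapMatrix_mul_apply {V W : Type*} [Fintype V] [DecidableEq V] {R : Type*} [CommRing R]
    (G : SimpleGraph V) [DecidableRel G.Adj] (P : Matrix V W R) (a : V) (b : W) :
    (G.lapMatrix R * P) a b = ∑ c ∈ G.neighborFinset a, (P a b - P c b) := by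
  have := SimpleGraph.lapMatrix_mulVec_apply (R := R) (G := G) a (fun c => P c b)
  rw [Finset.sum_sub_distrib, Finset.sum_const, SimpleGraph.card_neighborFinset_eq_degree,
    nsmul_eq_mul]
  exact this

/-! ### Cartesian powers and tensor products of eigenvectors. -/

/-- `G` is the Cartesian power of `H` with index set `ι`. -/
def IsCartesianPower {ι α : Type*} (H : SimpleGraph α) (G : SimpleGraph (ι → α)) : Prop :=
  ∀ a b, G.Adj a b ↔ ∃ i, H.Adj (a i) (b i) ∧ ∀ j, j ≠ i → a j = b j

/-- The tensor power of a matrix. -/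
def tensorPower {ι α R : Type*} [Fintype ι] [CommRing R] (P : Matrix α α R) :
    Matrix (ι → α) (ι → α) R :=
  fun a b => ∏ i, P (a i) (b i)

theorem tensorPower_mul {ι α R : Type*} [Fintype ι] [DecidableEq ι] [Fintype α] [CommRing R]
    (P Q : Matrix α α R) :
    tensorPower (ι := ι) P * tensorPower Q = tensorPower (P * Q) := by
  ext a b
  simp only [Matrix.mul_apply, tensorPower, ← Finset.prod_mul_distrib]
  rw [Finset.prod_univ_sum]
  simp

theorem tensorPower_one {ι α R : Type*} [Fintype ι] [DecidableEq ι] [DecidableEq α] [CommRing R] :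
    tensorPower (1 : Matrix α α R) = (1 : Matrix (ι → α) (ι → α) R) := by
  ext a b
  by_cases h : a = b
  · subst h
    simp [tensorPower]
  · obtain ⟨i, hi⟩ := Function.ne_iff.1 h
    rw [Matrix.one_apply_ne h]
    exact Finset.prod_eq_zero (Finset.mem_univ i) (Matrix.one_apply_ne hi)

theorem IsCartesianPower.sum_neighborFinset {ι α M : Type*} [Fintype ι] [DecidableEq ι] [Fintype α]
    [DecidableEq α] [AddCommMonoid M] {H : SimpleGraph α} {G : SimpleGraph (ι → α)}
    [DecidableRel H.Adj] [DecidableRel G.Adj] (hG : IsCartesianPower H G) (h : (ι → α) → M)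
    (a : ι → α) :
    ∑ b ∈ G.neighborFinset a, h b =
      ∑ i, ∑ c ∈ H.neighborFinset (a i), h (Function.update a i c) := by
  rw [Finset.sum_sigma']
  symm
  refine Finset.sum_bij (fun x _ => Function.update a x.1 x.2) ?_ ?_ ?_ ?_
  · rintro ⟨i, c⟩ hc
    rw [Finset.mem_sigma, SimpleGraph.mem_neighborFinset] at hc
    rw [SimpleGraph.mem_neighborFinset, hG]
    exact ⟨i, by simpa using hc.2, fun j hj => by simp [hj]⟩
  · rintro ⟨i, c⟩ hc ⟨i', c'⟩ hc' heq
    rw [Finset.mem_sigma, SimpleGraph.mem_neighborFinset] at hc hc'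
    have h1 := congrFun heq i
    by_cases hii : i = i'
    · subst hii
      simp only [Function.update_self] at h1
      rw [h1]
    · simp only [Function.update_self, Function.update_of_ne hii] at h1
      exact absurd h1 hc.2.ne'
  · intro b hb
    rw [SimpleGraph.mem_neighborFinset, hG] at hb
    obtain ⟨i, hi, hj⟩ := hb
    refine ⟨⟨i, b i⟩, by simpa using hi, ?_⟩
    ext j
    by_cases hji : j = i
    · subst hji
      simp
    · simp [hji, hj j hji]
  · intros
    rfl

/-- The Laplacian of the power is a sum over coordinates of copies of that of `H`, each acting on a
single tensor factor; hence eigenvalues add. -/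
theorem IsCartesianPower.lapMatrix_mul_tensorPower {ι α R : Type*} [Fintype ι] [DecidableEq ι]
    [Fintype α] [DecidableEq α] [CommRing R] {H : SimpleGraph α} {G : SimpleGraph (ι → α)}
    [DecidableRel H.Adj] [DecidableRel G.Adj] (hG : IsCartesianPower H G) {P : Matrix α α R}
    {d : α → R} (h : H.lapMatrix R * P = P * Matrix.diagonal d) :
    G.lapMatrix R * tensorPower P = tensorPower P * Matrix.diagonal fun b => ∑ i, d (b i) := by
  ext a b
  rw [lapMatrix_mul_apply, hG.sum_neighborFinset, Matrix.mul_diagonal, Finset.mul_sum]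
  refine Finset.sum_congr rfl fun i _ => ?_
  have h1 := congrFun (congrFun h (a i)) (b i)
  rw [lapMatrix_mul_apply, Matrix.mul_diagonal] at h1
  have h2 : ∀ c, tensorPower P (Function.update a i c) b =
      P c (b i) * ∏ j ∈ Finset.univ.erase i, P (a j) (b j) := by
    intro c
    rw [tensorPower, ← Finset.mul_prod_erase _ _ (Finset.mem_univ i), Function.update_self]
    congr 1
    refine Finset.prod_congr rfl fun j hj => ?_
    rw [Function.update_of_ne (Finset.ne_of_mem_erase hj)]
  have h3 : tensorPower P a b = P (a i) (b i) * ∏ j ∈ Finset.univ.erase i, P (a j) (b j) := by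
    rw [← h2, Function.update_eq_self]
  simp only [h2, h3, ← sub_mul]
  rw [← Finset.sum_mul, h1]
  ring

/-! ### The nonbinary hypercube as a power of a star. -/

/-- The star with centre `0`. -/
def finStar (m : ℕ) : SimpleGraph (Fin (m + 1)) where
  Adj a b := (a = 0 ∧ b ≠ 0) ∨ (a ≠ 0 ∧ b = 0)
  symm := ⟨fun a b h => by tauto⟩
  loopless := ⟨fun a h => by tauto⟩

instance (m : ℕ) : DecidableRel (finStar m).Adj :=
  fun a b => inferInstanceAs (Decidable ((a = 0 ∧ b ≠ 0) ∨ (a ≠ 0 ∧ b = 0)))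

theorem finStar_adj {m : ℕ} {a b : Fin (m + 1)} :
    (finStar m).Adj a b ↔ (a = 0 ∧ b ≠ 0) ∨ (a ≠ 0 ∧ b = 0) :=
  Iff.rfl

theorem tupleSupp_subset_iff {m n : ℕ} (a b : Fin n → Fin (m + 1)) :
    (tupleSupp a ⊆ tupleSupp b ∧ (tupleSupp a).card + 1 = (tupleSupp b).card ∧
      ∀ i ∈ tupleSupp a ∩ tupleSupp b, a i = b i) ↔
    ∃ i, (a i = 0 ∧ b i ≠ 0) ∧ ∀ j, j ≠ i → a j = b j := by
  have hmem : ∀ (c : Fin n → Fin (m + 1)) i, i ∈ tupleSupp c ↔ c i ≠ 0 := by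
    intro c i
    simp only [tupleSupp, Finset.mem_filter, Finset.mem_univ, true_and, ne_eq, Fin.ext_iff,
      Fin.val_zero]
  rw [← and_assoc, ← Finset.exists_eq_insert_iff]
  constructor
  · rintro ⟨⟨i, hi, hins⟩, hag⟩
    have hib : i ∈ tupleSupp b := by rw [← hins]; exact Finset.mem_insert_self _ _
    refine ⟨i, ⟨by simpa [hmem] using hi, (hmem b i).1 hib⟩, fun j hj => ?_⟩
    have hiff : j ∈ tupleSupp b ↔ j ∈ tupleSupp a := by
      rw [← hins, Finset.mem_insert]
      tauto
    by_cases hja : j ∈ tupleSupp a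
    · exact hag j (Finset.mem_inter.2 ⟨hja, hiff.2 hja⟩)
    · have h1 : a j = 0 := by simpa [hmem] using hja
      have h2 : b j = 0 := by
        have := mt hiff.1 hja
        simpa [hmem] using this
      rw [h1, h2]
  · rintro ⟨i, ⟨ha, hb⟩, hj⟩
    refine ⟨⟨i, by simpa [hmem] using ha, ?_⟩, ?_⟩
    · ext j
      rw [Finset.mem_insert, hmem, hmem]
      by_cases hji : j = i
      · subst hji
        simp [hb]
      · simp [hji, hj j hji]
    · intro j hjm
      refine hj j ?_
      rintro rfl
      exact (hmem a j).1 (Finset.mem_inter.1 hjm).1 ha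

theorem nonbinaryHypercube_isCartesianPower (m n : ℕ) :
    IsCartesianPower (finStar m) (nonbinaryHypercube (m + 1) n) := by
  intro a b
  have h1 := tupleSupp_subset_iff a b
  have h2 := tupleSupp_subset_iff b a
  have h3 : (∃ i, (finStar m).Adj (a i) (b i) ∧ ∀ j, j ≠ i → a j = b j) ↔
      (∃ i, (a i = 0 ∧ b i ≠ 0) ∧ ∀ j, j ≠ i → a j = b j) ∨
        ∃ i, (b i = 0 ∧ a i ≠ 0) ∧ ∀ j, j ≠ i → b j = a j := by
    rw [← exists_or]
    refine exists_congr fun i => ?_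
    have : (∀ j, j ≠ i → b j = a j) ↔ ∀ j, j ≠ i → a j = b j :=
      forall₂_congr fun _ _ => eq_comm
    rw [finStar_adj, this]
    tauto
  rw [h3, ← h1, ← h2]
  have h4 : (∀ i ∈ tupleSupp b ∩ tupleSupp a, b i = a i) ↔
      ∀ i ∈ tupleSupp a ∩ tupleSupp b, a i = b i := by
    rw [Finset.inter_comm]
    exact forall₂_congr fun _ _ => eq_comm
  rw [h4]
  change (_ ∧ _ ∧ _) ↔ _
  constructor
  · rintro ⟨h | h, hc, hag⟩
    · refine Or.inl ⟨h, ?_, hag⟩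
      have := Finset.card_le_card h
      rw [abs_eq one_pos.le] at hc
      omega
    · refine Or.inr ⟨h, ?_, hag⟩
      have := Finset.card_le_card h
      rw [abs_eq one_pos.le] at hc
      omega
  · rintro (⟨h, hc, hag⟩ | ⟨h, hc, hag⟩)
    · refine ⟨Or.inl h, ?_, hag⟩
      rw [abs_eq one_pos.le]
      omega
    · refine ⟨Or.inr h, ?_, hag⟩
      rw [abs_eq one_pos.le]
      omega

/-! ### Spectrum of the star and of the hypercube. -/

/-- The Laplacian eigenvalues of the star with `p + 1` leaves. -/
def starEigenvalue (p : ℕ) : Fin (p + 2) → ℚ :=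
  Fin.cons 0 (Fin.cons ((p : ℚ) + 2) fun _ => 1)

/-- The columns are Laplacian eigenvectors of the star with `p + 1` leaves. -/
def starEigenmatrix (p : ℕ) : Matrix (Fin (p + 2)) (Fin (p + 2)) ℚ :=
  fun a => Fin.cons 1 (Fin.cons (if a = 0 then -((p : ℚ) + 1) else 1)
    fun j => (if a = j.succ.succ then 1 else 0) - if a = 1 then 1 else 0)

theorem finStar_neighborFinset_zero (m : ℕ) :
    (finStar m).neighborFinset 0 = Finset.univ.map (Fin.succEmb m) := by
  ext b
  simp [finStar_adj, Fin.exists_succ_eq]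

theorem finStar_neighborFinset_succ {m : ℕ} (i : Fin m) :
    (finStar m).neighborFinset i.succ = {0} := by
  ext b
  simp [finStar_adj]

theorem lapMatrix_mul_starEigenmatrix (p : ℕ) :
    (finStar (p + 1)).lapMatrix ℚ * starEigenmatrix p =
      starEigenmatrix p * Matrix.diagonal (starEigenvalue p) := by
  ext a b
  rw [lapMatrix_mul_apply, Matrix.mul_diagonal]
  refine Fin.cases ?_ (fun i => ?_) a
  · rw [finStar_neighborFinset_zero, Finset.sum_map]
    refine Fin.cases ?_ (fun j => Fin.cases ?_ (fun k => ?_) j) b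
    · simp [starEigenmatrix, starEigenvalue]
    · simp [starEigenmatrix, starEigenvalue, Fin.succ_ne_zero]
      ring
    · simp [starEigenmatrix, starEigenvalue, Fin.succ_ne_zero, (Fin.succ_ne_zero _).symm,
        Fin.sum_univ_succ, Fin.succ_succ_ne_one]
  · rw [finStar_neighborFinset_succ, Finset.sum_singleton]
    refine Fin.cases ?_ (fun j => Fin.cases ?_ (fun k => ?_) j) b
    · simp [starEigenmatrix, starEigenvalue]
    · simp [starEigenmatrix, starEigenvalue, Fin.succ_ne_zero]
      ring
    · simp [starEigenmatrix, starEigenvalue, Fin.succ_ne_zero, (Fin.succ_ne_zero _).symm]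

theorem exists_starEigenmatrix_mul_eq_one (p : ℕ) :
    ∃ Q : Matrix (Fin (p + 2)) (Fin (p + 2)) ℚ, starEigenmatrix p * Q = 1 := by
  refine ⟨_, Matrix.mul_nonsing_inv _ (isUnit_iff_ne_zero.2 fun hdet => ?_)⟩
  obtain ⟨v, hv, h⟩ := Matrix.exists_mulVec_eq_zero_iff.2 hdet
  apply hv
  have h0 := congrFun h 0
  have h1 := congrFun h 1
  have h2 := fun k : Fin p => congrFun h k.succ.succ
  simp only [Matrix.mulVec, dotProduct, Fin.sum_univ_succ, starEigenmatrix, Pi.zero_apply] at h0 h1 h2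
  simp [Fin.succ_ne_zero, (Fin.succ_ne_zero _).symm,
    Fin.succ_succ_ne_one, (Fin.succ_succ_ne_one _).symm] at h0 h1 h2
  have hp : (p : ℚ) + 1 ≠ 0 := by positivity
  have hp' : (p : ℚ) + 2 ≠ 0 := by positivity
  -- Rows beyond the first two express each remaining entry through `v 0 + v 1`; row `1` then reads
  -- `(p + 1) (v 0 + v 1) = 0`, and row `0` is `v 0 = (p + 1) v 1`.
  have hk : ∀ k : Fin p, v k.succ.succ = -(v 0 + v 1) := fun k => by linear_combination h2 k
  simp only [hk, Finset.sum_const, Finset.card_univ, Fintype.card_fin, nsmul_eq_mul] at h1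
  have h01 : v 0 + v 1 = 0 := by
    refine (mul_eq_zero.1 ?_).resolve_left hp
    linear_combination h1
  have hv1 : v 1 = 0 := by
    refine (mul_eq_zero.1 ?_).resolve_left hp'
    linear_combination h01 - h0
  have hv0 : v 0 = 0 := by linear_combination h01 - hv1
  funext i
  refine Fin.cases hv0 (fun j => Fin.cases hv1 (fun k => ?_) j) i
  rw [hk, h01, neg_zero, Pi.zero_apply]

/-- The product of the nonzero Laplacian eigenvalues. -/
theorem pow_mul_complexity_nonbinaryHypercube (p n : ℕ) :
    ((p : ℚ) + 2) ^ n * complexity (nonbinaryHypercube (p + 2) n) =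
      ∏ b ∈ (Finset.univ : Finset (Fin n → Fin (p + 2))).erase 0, ∑ i, starEigenvalue p (b i) := by
  classical
  obtain ⟨Q, hQ⟩ := exists_starEigenmatrix_mul_eq_one p
  have := card_mul_complexity_eq_prod (nonbinaryHypercube (p + 2) n)
    (P := tensorPower (starEigenmatrix p)) (Q := tensorPower Q) (i₀ := 0)
    (by rw [tensorPower_mul, hQ, tensorPower_one])
    ((nonbinaryHypercube_isCartesianPower (p + 1) n).lapMatrix_mul_tensorPower
      (lapMatrix_mul_starEigenmatrix p)) (by simp [starEigenvalue])
  rw [← this]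
  simp

/-! ### Multiplicities of the eigenvalues. -/

/-- Grouping tuples by the sets of coordinates with entry at least `2` and with entry `1`. -/
theorem prod_tuples_eq_prod_powerset {M : Type*} [CommMonoid M] (p n : ℕ)
    (F : Finset (Fin n) → Finset (Fin n) → M) :
    ∏ b : Fin n → Fin (p + 2),
        F (Finset.univ.filter fun i => b i ≠ 0 ∧ b i ≠ 1) (Finset.univ.filter fun i => b i = 1) =
      ∏ A : Finset (Fin n), ∏ B ∈ (Finset.univ \ A).powerset, F A B ^ p ^ A.card := by
  rw [← Finset.prod_fiberwise Finset.univ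
    (fun b : Fin n → Fin (p + 2) => Finset.univ.filter fun i => b i ≠ 0 ∧ b i ≠ 1)]
  refine Finset.prod_congr rfl fun A _ => ?_
  rw [← Finset.prod_fiberwise_of_maps_to
    (g := fun b : Fin n → Fin (p + 2) => Finset.univ.filter fun i => b i = 1)
    (t := (Finset.univ \ A).powerset)]
  · refine Finset.prod_congr rfl fun B hB => ?_
    have hdisj : ∀ i, i ∈ B → i ∉ A := fun i hi => by
      simpa using Finset.mem_powerset.1 hB hi
    rw [Finset.prod_congr rfl (g := fun _ => F A B), Finset.prod_const]
    · congr 1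
      -- The fibre is a box: `p` choices at each coordinate in `A`, one elsewhere.
      have hfib : ((Finset.univ.filter fun b : Fin n → Fin (p + 2) =>
          (Finset.univ.filter fun i => b i ≠ 0 ∧ b i ≠ 1) = A).filter fun b =>
          (Finset.univ.filter fun i => b i = 1) = B) =
          Fintype.piFinset fun i => if i ∈ A then (Finset.univ.erase 0).erase 1
            else if i ∈ B then {1} else {0} := by
        ext b
        simp only [Finset.mem_filter, Finset.mem_univ, true_and, Fintype.mem_piFinset,
          Finset.ext_iff]
        constructor
        · rintro ⟨h1, h2⟩ i
          have h1 := h1 i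
          have h2 := h2 i
          split_ifs with hA hB
          · simpa [and_comm] using h1.2 hA
          · simpa using h2.2 hB
          · rw [Finset.mem_singleton]
            tauto
        · intro h
          have h01 : (0 : Fin (p + 2)) ≠ 1 := Fin.zero_ne_one
          refine ⟨fun i => ?_, fun i => ?_⟩
          · have hi := h i
            split_ifs at hi with hA hB
            · simpa [hA, and_comm] using hi
            · simp [hA, Finset.mem_singleton.1 hi]
            · simp [hA, Finset.mem_singleton.1 hi]
          · have hi := h i
            split_ifs at hi with hA hB
            · have hB : i ∉ B := fun hB => hdisj i hB hA
              simp only [Finset.mem_erase] at hi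
              tauto
            · simp [hB, Finset.mem_singleton.1 hi]
            · simp [hB, Finset.mem_singleton.1 hi]
      rw [hfib, Fintype.card_piFinset, ← Finset.prod_subset (Finset.subset_univ A)]
      · rw [Finset.prod_congr rfl (g := fun _ => p), Finset.prod_const]
        intro i hi
        rw [if_pos hi, Finset.card_erase_of_mem, Finset.card_erase_of_mem (Finset.mem_univ _)]
        · simp
        · simp
      · intro i _ hi
        rw [if_neg hi]
        split_ifs <;> rfl
    · intro b hb
      simp only [Finset.mem_filter, Finset.mem_univ, true_and] at hb
      simp only [ne_eq] at hb ⊢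
      rw [hb.1, hb.2]
  · intro b hb
    simp only [Finset.mem_filter, Finset.mem_univ, true_and] at hb
    rw [Finset.mem_powerset, ← hb]
    intro i hi
    simp only [Finset.mem_filter, Finset.mem_univ, true_and] at hi
    simp [hi]

theorem prod_powerset_apply_card {M α : Type*} [CommMonoid M] (f : ℕ → M) (s : Finset α) :
    ∏ t ∈ s.powerset, f t.card = ∏ m ∈ Finset.range (s.card + 1), f m ^ s.card.choose m := by
  rw [Finset.prod_powerset]
  refine Finset.prod_congr rfl fun m _ => ?_
  rw [Finset.prod_congr rfl (g := fun _ => f m), Finset.prod_const, Finset.card_powersetCard]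
  intro t ht
  rw [(Finset.mem_powersetCard.1 ht).2]

/-- The Laplacian eigenvalue of a tuple with `l` entries at least `2` and `m` entries `1`, with
the eigenvalue `0` replaced by `1`. -/
def positiveEigenvalue (p l m : ℕ) : ℚ :=
  if l = 0 ∧ m = 0 then 1 else l + (p + 2) * m

theorem sum_starEigenvalue (p n : ℕ) (b : Fin n → Fin (p + 2)) :
    ∑ i, starEigenvalue p (b i) =
      ((Finset.univ.filter fun i => b i ≠ 0 ∧ b i ≠ 1).card : ℚ) +
        (p + 2) * (Finset.univ.filter fun i => b i = 1).card := by
  rw [← Finset.sum_boole, ← Finset.sum_boole, Finset.mul_sum, ← Finset.sum_add_distrib]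
  refine Finset.sum_congr rfl fun i _ => ?_
  refine Fin.cases ?_ (fun j => Fin.cases ?_ (fun k => ?_) j) (b i)
  · simp [starEigenvalue]
  · simp [starEigenvalue]
  · simp [starEigenvalue, Fin.succ_succ_ne_one, Fin.succ_ne_zero]

theorem prod_eigenvalues_eq (p n : ℕ) :
    ∏ b ∈ (Finset.univ : Finset (Fin n → Fin (p + 2))).erase 0, ∑ i, starEigenvalue p (b i) =
      ∏ l ∈ Finset.range (n + 1), ∏ m ∈ Finset.range (n - l + 1),
        positiveEigenvalue p l m ^ (p ^ l * n.choose l * (n - l).choose m) := by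
  have h1 : ∏ b ∈ (Finset.univ : Finset (Fin n → Fin (p + 2))).erase 0,
      ∑ i, starEigenvalue p (b i) = ∏ b : Fin n → Fin (p + 2), positiveEigenvalue p
        (Finset.univ.filter fun i => b i ≠ 0 ∧ b i ≠ 1).card
        (Finset.univ.filter fun i => b i = 1).card := by
    rw [← Finset.mul_prod_erase Finset.univ _ (Finset.mem_univ 0)]
    have h0 : positiveEigenvalue p
        (Finset.univ.filter fun i => (0 : Fin n → Fin (p + 2)) i ≠ 0 ∧
          (0 : Fin n → Fin (p + 2)) i ≠ 1).card
        (Finset.univ.filter fun i => (0 : Fin n → Fin (p + 2)) i = 1).card = 1 := by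
      simp [positiveEigenvalue]
    rw [h0, one_mul]
    refine Finset.prod_congr rfl fun b hb => ?_
    rw [sum_starEigenvalue, positiveEigenvalue, if_neg]
    rintro ⟨h2, h3⟩
    rw [Finset.card_eq_zero, Finset.filter_eq_empty_iff] at h2 h3
    refine Finset.ne_of_mem_erase hb (funext fun i => ?_)
    have h2 := h2 (Finset.mem_univ i)
    have h3 := h3 (Finset.mem_univ i)
    rw [Pi.zero_apply]
    tauto
  rw [h1, prod_tuples_eq_prod_powerset p n fun A B => positiveEigenvalue p A.card B.card]
  have h2 : ∀ A : Finset (Fin n), ∏ B ∈ (Finset.univ \ A).powerset,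
      positiveEigenvalue p A.card B.card ^ p ^ A.card =
      ∏ m ∈ Finset.range (n - A.card + 1),
        (positiveEigenvalue p A.card m ^ p ^ A.card) ^ (n - A.card).choose m := by
    intro A
    rw [prod_powerset_apply_card (fun m => positiveEigenvalue p A.card m ^ p ^ A.card),
      Finset.card_univ_sdiff, Fintype.card_fin]
  rw [Finset.prod_congr rfl fun A _ => h2 A, ← Finset.powerset_univ,
    prod_powerset_apply_card (fun l => ∏ m ∈ Finset.range (n - l + 1),
        (positiveEigenvalue p l m ^ p ^ l) ^ (n - l).choose m), Finset.card_univ, Fintype.card_fin]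
  refine Finset.prod_congr rfl fun l _ => ?_
  rw [← Finset.prod_pow]
  refine Finset.prod_congr rfl fun m _ => ?_
  rw [← pow_mul, ← pow_mul]
  congr 1
  ring

/-! ### Telescoping and reordering of the product. -/

/-- The alternative `s = ∅` serves the zero base `l = m = 0`, where exponents cannot be added
freely. -/
theorem prod_zpow_eq_zpow_sum {ι K : Type*} [Field K] {x : K} {s : Finset ι}
    (h : x ≠ 0 ∨ s = ∅) (z : ι → ℤ) : ∏ k ∈ s, x ^ z k = x ^ ∑ k ∈ s, z k := by
  classical
  rcases h with hx | rfl
  · induction s using Finset.induction_on with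
    | empty => simp
    | insert a s ha ih => rw [Finset.prod_insert ha, Finset.sum_insert ha, zpow_add₀ hx, ih]
  · simp

theorem sum_Icc_sub_pred (β : ℤ → ℤ) (a b : ℕ) (h : a ≤ b + 1) :
    ∑ k ∈ Finset.Icc a b, (β (k : ℤ) - β ((k : ℤ) - 1)) = β b - β ((a : ℤ) - 1) := by
  obtain ⟨c, hc⟩ : ∃ c, b + 1 = a + c := Nat.exists_eq_add_of_le h
  have h1 : Finset.Icc a b = Finset.Ico a (a + c) := by
    ext x
    simp only [Finset.mem_Icc, Finset.mem_Ico]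
    omega
  rw [h1, Finset.sum_Ico_eq_sum_range]
  have hb : (b : ℤ) = a + c - 1 := by omega
  have := Finset.sum_range_sub (fun i : ℕ => β ((a : ℤ) + i - 1)) c
  simp only [Nat.cast_zero, add_zero] at this
  rw [hb, ← this, Nat.add_sub_cancel_left]
  refine Finset.sum_congr rfl fun i _ => ?_
  push_cast
  congr 2
  ring

theorem binom_natCast_sub {m a b : ℕ} (h : b ≤ a) : binom m ((a : ℤ) - b) = m.choose (a - b) := by
  rw [binom, if_pos (by omega)]
  congr 2
  omega

theorem binom_of_neg {m : ℕ} {j : ℤ} (h : j < 0) : binom m j = 0 :=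
  if_neg (by omega)

/-- The multiplicities telescope. -/
theorem sum_binom_sub_binom {n l j : ℕ} (hlj : l ≤ j) (hjn : j ≤ n) :
    ∑ k ∈ Finset.Icc (max l 1) (min j (n + l - j)),
        (binom (n - l) ((k : ℤ) - l) - binom (n - l) ((k : ℤ) - l - 1)) =
      (n - l).choose (j - l) - if l = 0 then 1 else 0 := by
  have h1 := sum_Icc_sub_pred (fun x => binom (n - l) (x - l)) (max l 1) (min j (n + l - j))
    (by omega)
  simp only [sub_right_comm _ (1 : ℤ)] at h1
  rw [h1, binom_natCast_sub (by omega)]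
  congr 1
  · rcases le_total j (n + l - j) with h | h
    · rw [min_eq_left h]
    -- The upper end `n + l - j` gives `C(n-l, n-j)`, equal by symmetry.
    · rw [min_eq_right h, ← Nat.choose_symm (show j - l ≤ n - l by omega)]
      congr 2
      omega
  -- For `l = 0` the sum starts at `k = 1`, leaving `C(n,0) = 1`; otherwise it starts at `k = l`,
  -- where the lower index is `-1`.
  · split_ifs with hl
    · subst hl
      simp [binom]
    · rw [max_eq_left (by omega)]
      exact binom_of_neg (by omega)

/-- Interchanging the products over `k` with those over `l` and `j = l + m`. -/
theorem prod_zpow_binom_eq (p n : ℕ) :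
    ∏ k ∈ Finset.Icc 1 n, ∏ l ∈ Finset.Icc (2 * k - n) k,
      (∏ j ∈ Finset.Icc k (n + l - k),
        (((p + 2 : ℕ) : ℚ) * (j : ℚ) - (((p + 2 : ℕ) : ℚ) - 1) * (l : ℚ))) ^
          ((((p + 2 : ℕ) : ℤ) - 2) ^ l * (n.choose l : ℤ) *
            (binom (n - l) ((k : ℤ) - (l : ℤ)) - binom (n - l) ((k : ℤ) - (l : ℤ) - 1))) =
    ∏ l ∈ Finset.range (n + 1), ∏ m ∈ Finset.range (n - l + 1),
      ((l : ℚ) + (p + 2) * m) ^ ((p : ℤ) ^ l * (n.choose l : ℤ) *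
        ((n - l).choose m - if l = 0 then 1 else 0)) := by
  rw [Finset.prod_comm' (t' := Finset.range (n + 1))
    (s' := fun l => Finset.Icc (max l 1) ((n + l) / 2))]
  · refine Finset.prod_congr rfl fun l hl => ?_
    rw [Finset.mem_range] at hl
    simp only [← Finset.prod_zpow]
    rw [Finset.prod_comm' (t' := Finset.Ico l (n + 1))
      (s' := fun j => Finset.Icc (max l 1) (min j (n + l - j)))]
    · rw [Finset.prod_Ico_eq_prod_range, Nat.succ_sub (by omega)]
      refine Finset.prod_congr rfl fun m hm => ?_
      rw [Finset.mem_range] at hm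
      rw [prod_zpow_eq_zpow_sum, ← Finset.mul_sum, sum_binom_sub_binom (by omega) (by omega)]
      · congr 1
        · push_cast
          ring
        · push_cast
          rw [add_sub_cancel_right, Nat.add_sub_cancel_left]
      -- If `l = m = 0`, then `k` would run from `1` to `0`.
      · by_cases h : l = 0 ∧ m = 0
        · right
          rw [h.1, h.2]
          simp
        · left
          have : 0 < l + (p + 2) * m := by
            rcases Nat.eq_zero_or_pos l with hl | hl
            · have : 0 < m := by omega
              positivity
            · positivity
          have : (0 : ℚ) < l + (p + 2) * m := by exact_mod_cast this
          refine ne_of_eq_of_ne ?_ this.ne'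
          push_cast
          ring
    · intro k j
      simp only [Finset.mem_Icc, Finset.mem_Ico]
      omega
  · intro k l
    simp only [Finset.mem_Icc, Finset.mem_range]
    omega

/-! ### Cancelling the number of vertices. -/

theorem prod_mul_natCast (x : ℚ) (n : ℕ) :
    ∏ m ∈ Finset.range n, (x * ((m + 1 : ℕ) : ℚ)) = x ^ n * n.factorial := by
  rw [Finset.prod_mul_distrib, Finset.prod_const, Finset.card_range, ← Nat.cast_prod,
    Finset.prod_range_add_one_eq_factorial]

/-- The factors with `l = 0`. -/
theorem prod_positiveEigenvalue_zero (p n : ℕ) :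
    ∏ m ∈ Finset.range (n + 1), positiveEigenvalue p 0 m ^ n.choose m =
      ((p : ℚ) + 2) ^ n * (n.factorial *
        ∏ m ∈ Finset.range (n + 1), (((p : ℚ) + 2) * m) ^ ((n.choose m : ℤ) - 1)) := by
  rw [← mul_assoc, ← prod_mul_natCast, Finset.prod_range_succ', Finset.prod_range_succ' _ n,
    ← mul_assoc, ← Finset.prod_mul_distrib]
  congr 1
  · refine Finset.prod_congr rfl fun m _ => ?_
    have : ((p : ℚ) + 2) * ((m + 1 : ℕ) : ℚ) ≠ 0 := by positivity
    rw [← zpow_one_add₀ this, add_sub_cancel, zpow_natCast]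
    simp [positiveEigenvalue]
  -- At `m = 0` the exponent is `C(n,0) - 1 = 0`, so the zero base contributes `1`.
  · simp [positiveEigenvalue]

theorem complexity_nonbinaryHypercube (p n : ℕ) :
    (complexity (nonbinaryHypercube (p + 2) n) : ℚ) = n.factorial *
      ∏ l ∈ Finset.range (n + 1), ∏ m ∈ Finset.range (n - l + 1),
        ((l : ℚ) + (p + 2) * m) ^ ((p : ℤ) ^ l * (n.choose l : ℤ) *
          ((n - l).choose m - if l = 0 then 1 else 0)) := by
  have hp : ((p : ℚ) + 2) ^ n ≠ 0 := by positivity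
  apply mul_left_cancel₀ hp
  rw [pow_mul_complexity_nonbinaryHypercube, prod_eigenvalues_eq, Finset.prod_range_succ',
    Finset.prod_range_succ' _ n, mul_comm, mul_comm (∏ k ∈ Finset.range n, _), ← mul_assoc,
    ← mul_assoc]
  refine congrArg₂ (· * ·) ?_ ?_
  · simpa [mul_assoc] using prod_positiveEigenvalue_zero p n
  · refine Finset.prod_congr rfl fun l _ => Finset.prod_congr rfl fun m _ => ?_
    rw [positiveEigenvalue, if_neg (by simp), if_neg (by simp), ← zpow_natCast]
    push_cast
    rw [sub_zero]

/-! ### The binary case. -/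

/-- Multiplied by `2^n`, both sides are the product of the positive eigenvalues for `p = 0`; on the
right, `2^n` is the missing factor `k = 1`. -/
theorem factorial_mul_prod_two (n : ℕ) :
    (n.factorial : ℚ) * ∏ m ∈ Finset.range (n + 1), (2 * (m : ℚ)) ^ ((n.choose m : ℤ) - 1) =
      ∏ k ∈ Finset.Icc 2 n, (2 * (k : ℚ)) ^ n.choose k := by
  have h := prod_positiveEigenvalue_zero 0 n
  simp only [Nat.cast_zero, zero_add] at h
  have h2 : (2 : ℚ) ^ n ≠ 0 := by positivity
  apply mul_left_cancel₀ h2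
  rw [← h]
  rcases n with _ | n
  · simp [positiveEigenvalue]
  · have hI : Finset.Icc 2 (n + 1) = Finset.Ico 2 (n + 1 + 1) := by
      ext x
      simp only [Finset.mem_Icc, Finset.mem_Ico]
      omega
    rw [Finset.prod_range_succ', Finset.prod_range_succ', hI, Finset.prod_Ico_eq_prod_range,
      mul_comm]
    simp [positiveEigenvalue, mul_comm]
    refine Finset.prod_congr rfl fun m _ => ?_
    rw [show 2 + m = m + 1 + 1 by ring]
    ring

theorem prod_two_eq (n : ℕ) :
    ∏ k ∈ Finset.Icc 1 n, ∏ l ∈ Finset.Icc (2 * k - n) k,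
      (∏ j ∈ Finset.Icc k (n + l - k),
        (((2 : ℕ) : ℚ) * (j : ℚ) - (((2 : ℕ) : ℚ) - 1) * (l : ℚ))) ^
          ((((2 : ℕ) : ℤ) - 2) ^ l * (n.choose l : ℤ) *
            (binom (n - l) ((k : ℤ) - (l : ℤ)) - binom (n - l) ((k : ℤ) - (l : ℤ) - 1))) =
    ∏ m ∈ Finset.range (n + 1), (2 * (m : ℚ)) ^ ((n.choose m : ℤ) - 1) := by
  have h := prod_zpow_binom_eq 0 n
  rw [zero_add] at h
  rw [h, Finset.prod_range_succ', Finset.prod_eq_one, one_mul]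
  · simp
  -- For `l > 0` the exponent contains `0^l = 0`.
  · intro l _
    refine Finset.prod_eq_one fun m _ => ?_
    simp

theorem prod_two_eq_prod_half (n : ℕ) :
    ∏ k ∈ Finset.Icc 1 n, ∏ l ∈ Finset.Icc (2 * k - n) k,
      (∏ j ∈ Finset.Icc k (n + l - k),
        (((2 : ℕ) : ℚ) * (j : ℚ) - (((2 : ℕ) : ℚ) - 1) * (l : ℚ))) ^
          ((((2 : ℕ) : ℤ) - 2) ^ l * (n.choose l : ℤ) *
            (binom (n - l) ((k : ℤ) - (l : ℤ)) - binom (n - l) ((k : ℤ) - (l : ℤ) - 1))) =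
    ∏ k ∈ Finset.Icc 1 (n / 2), (∏ j ∈ Finset.Icc k (n - k), (2 * (j : ℚ))) ^
      ((n.choose k : ℤ) - (n.choose (k - 1) : ℤ)) := by
  have hsub : Finset.Icc 1 (n / 2) ⊆ Finset.Icc 1 n :=
    Finset.Icc_subset_Icc_right (Nat.div_le_self n 2)
  have hpos : ∀ l, l ≠ 0 → (((2 : ℕ) : ℤ) - 2) ^ l = 0 := fun l hl => by simp [hl]
  rw [← Finset.prod_subset hsub]
  · refine Finset.prod_congr rfl fun k hk => ?_
    rw [Finset.mem_Icc] at hk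
    rw [Finset.prod_eq_single_of_mem 0 (Finset.mem_Icc.2 ⟨by omega, by omega⟩)]
    · have h1 : binom n (k : ℤ) = n.choose k := by simp [binom]
      have h2 : binom n ((k : ℤ) - 1) = n.choose (k - 1) := by
        simpa using binom_natCast_sub (m := n) hk.1
      simp [h1, h2]
    · intro l _ hl
      rw [hpos l hl, zero_mul, zero_mul, zpow_zero]
  -- If `k > n / 2`, then `l ≥ 2k - n > 0`, so every exponent vanishes.
  · intro k hk hk'
    rw [Finset.mem_Icc] at hk hk'
    refine Finset.prod_eq_one fun l hl => ?_
    rw [Finset.mem_Icc] at hl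
    rw [hpos l (by omega), zero_mul, zero_mul, zpow_zero]

/-- A binary tuple is determined by its support, and agreement on common supports is automatic
because all entries there are `1`. -/
theorem nonempty_nonbinaryHypercube_two_iso (n : ℕ) :
    Nonempty (nonbinaryHypercube 2 n ≃g binaryHypercube n) := by
  have hmem : ∀ (c : Fin n → Fin 2) i, i ∈ tupleSupp c ↔ c i = 1 := by
    intro c i
    simp only [tupleSupp, Finset.mem_filter, Finset.mem_univ, true_and]
    omega
  let e : (Fin n → Fin 2) ≃ Finset (Fin n) :=
    { toFun := tupleSupp
      invFun := fun X i => if i ∈ X then 1 else 0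
      left_inv := fun a => by
        ext i
        simp only [hmem]
        split_ifs <;> omega
      right_inv := fun X => by
        ext i
        simp [hmem] }
  refine ⟨⟨e, fun {a b} => ?_⟩⟩
  change (_ ∧ _) ↔ (_ ∧ _ ∧ _)
  refine and_congr_right fun _ => (and_iff_left ?_).symm
  intro i hi
  rw [Finset.mem_inter, hmem, hmem] at hi
  rw [hi.1, hi.2]

theorem complexity_congr {V W : Type*} {G : SimpleGraph V} {H : SimpleGraph W} (e : G ≃g H) :
    complexity G = complexity H := by
  have hiff : ∀ T : SimpleGraph W, (T.comap e).IsTree ↔ T.IsTree := fun T =>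
    (SimpleGraph.Iso.comap e.toEquiv T).isTree_iff
  symm
  refine Set.ncard_congr (fun T _ => T.comap e) ?_ ?_ ?_
  · rintro T ⟨h1, h2⟩
    exact ⟨fun a b hab => e.map_adj_iff.1 (h1 hab), (hiff T).2 h2⟩
  · intro S T _ _ h
    ext a b
    obtain ⟨a, rfl⟩ := e.surjective a
    obtain ⟨b, rfl⟩ := e.surjective b
    exact iff_of_eq (congrArg (fun K => K.Adj a b) h)
  · rintro T ⟨h1, h2⟩
    have hT : (T.comap e.symm).comap e = T := by
      ext a b
      simp
    refine ⟨T.comap e.symm, ⟨fun a b hab => e.symm.map_adj_iff.1 (h1 hab), ?_⟩, hT⟩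
    rw [← hiff, hT]
    exact h2
theorem theorem1 (n : ℕ) :
    -- the formula for `c(C_q(n))`; the lower limit `2 * k - n` is a natural-number subtraction,
    -- that is, `max {0, 2k - n}`
    (∀ q : ℕ, 2 ≤ q →
      (complexity (nonbinaryHypercube q n) : ℚ) =
        (n.factorial : ℚ) *
          ∏ k ∈ Finset.Icc 1 n, ∏ l ∈ Finset.Icc (2 * k - n) k,
            (∏ j ∈ Finset.Icc k (n + l - k), ((q : ℚ) * (j : ℚ) - ((q : ℚ) - 1) * (l : ℚ))) ^
              (((q : ℤ) - 2) ^ l * (n.choose l : ℤ) *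
                (binom (n - l) ((k : ℤ) - (l : ℤ)) - binom (n - l) ((k : ℤ) - (l : ℤ) - 1)))) ∧
    -- for `q = 2` the graph is the binary hypercube
    Nonempty (nonbinaryHypercube 2 n ≃g binaryHypercube n) ∧
    -- for `q = 2` the right-hand side reduces to the terms with `l = 0`
    (n.factorial : ℚ) *
        ∏ k ∈ Finset.Icc 1 n, ∏ l ∈ Finset.Icc (2 * k - n) k,
          (∏ j ∈ Finset.Icc k (n + l - k), (((2 : ℕ) : ℚ) * (j : ℚ) - (((2 : ℕ) : ℚ) - 1) * (l : ℚ))) ^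
            ((((2 : ℕ) : ℤ) - 2) ^ l * (n.choose l : ℤ) *
              (binom (n - l) ((k : ℤ) - (l : ℤ)) - binom (n - l) ((k : ℤ) - (l : ℤ) - 1))) =
      (n.factorial : ℚ) *
        ∏ k ∈ Finset.Icc 1 (n / 2),
          (∏ j ∈ Finset.Icc k (n - k), (2 * (j : ℚ))) ^
            ((n.choose k : ℤ) - (n.choose (k - 1) : ℤ)) ∧
    -- which is the classical formula for the complexity of the binary hypercube
    (n.factorial : ℚ) *
        ∏ k ∈ Finset.Icc 1 (n / 2),
          (∏ j ∈ Finset.Icc k (n - k), (2 * (j : ℚ))) ^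
            ((n.choose k : ℤ) - (n.choose (k - 1) : ℤ)) =
      ∏ k ∈ Finset.Icc 2 n, (2 * (k : ℚ)) ^ n.choose k ∧
    complexity (binaryHypercube n) = ∏ k ∈ Finset.Icc 2 n, (2 * k) ^ n.choose k := by

  have hcomplexity : ∀ q : ℕ, 2 ≤ q →
      (complexity (nonbinaryHypercube q n) : ℚ) =
        (n.factorial : ℚ) *
          ∏ k ∈ Finset.Icc 1 n, ∏ l ∈ Finset.Icc (2 * k - n) k,
            (∏ j ∈ Finset.Icc k (n + l - k), ((q : ℚ) * (j : ℚ) - ((q : ℚ) - 1) * (l : ℚ))) ^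
              (((q : ℤ) - 2) ^ l * (n.choose l : ℤ) *
                (binom (n - l) ((k : ℤ) - (l : ℤ)) - binom (n - l) ((k : ℤ) - (l : ℤ) - 1))) := by
    intro q hq
    obtain ⟨p, rfl⟩ : ∃ p, q = p + 2 := ⟨q - 2, by omega⟩
    rw [complexity_nonbinaryHypercube, prod_zpow_binom_eq]
  obtain ⟨e⟩ := nonempty_nonbinaryHypercube_two_iso n
  have hclassical : (n.factorial : ℚ) *
        ∏ k ∈ Finset.Icc 1 (n / 2),
          (∏ j ∈ Finset.Icc k (n - k), (2 * (j : ℚ))) ^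
            ((n.choose k : ℤ) - (n.choose (k - 1) : ℤ)) =
      ∏ k ∈ Finset.Icc 2 n, (2 * (k : ℚ)) ^ n.choose k := by
    rw [← prod_two_eq_prod_half, prod_two_eq, factorial_mul_prod_two]
  refine ⟨hcomplexity, ⟨e⟩, by rw [prod_two_eq_prod_half], hclassical, ?_⟩
  have h := hcomplexity 2 le_rfl
  rw [prod_two_eq_prod_half, hclassical, complexity_congr e] at h
  exact_mod_cast h
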